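/- Let $d\ge 1$, $0<\alpha<2$, and let $M$ be a symmetric $\alpha$-stable random measure on $[0,1]^d$ with Lebesgue control measure $|\cdot|$, i.e. a random set function on the Borel sets that is independently scattered (its values on disjoint sets are independent), almost surely $\sigma$-additive, and such that $M(A)$ has the law $S_\alpha(|A|^{1/\alpha},0,0)$, with characteristic function $t\mapsto \exp(-|A|\,|t|^\alpha)$. Let $U$ be the symmetric $\alpha$-stable sheet driven by $M$: a random field on $[0,1]^d$ such that, for every $x$, almost surely $$U(x)=\int_{[0,1]^d} f(x,x')\,M(dx'),\qquad f(x,x')=1 \text{ if } x_i'\le x_i \text{ for all } i,\quad f(x,x')=0 \text{ otherwise},$$ the stochastic integral being the limit in probability of the integrals of simple functions converging in $L^\alpha([0,1]^d)$. For $N\in\mathbb N$, $N\ge 1$, put $h=1/N$ and let $$U^N(x)=U(h\lceil x/h\rceil),\qquad x\in[0,1]^d,$$ where $\lceil\cdot\rceil$ is the coordinatewise ceiling. 1. For $n\in\{1,\dots,N\}^d$ let $C_n=\prod_{i=1}^d (h(n_i-1),hn_i]$. The increments $M(C_n)$ are independent with law $S_\alpha(h^{d/\alpha},0,0)$, and almost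 surely, for all $x\in[0,1]^d$, $$U^N(x)=\sum_{n:\ n_i\le \lceil x_i/h\rceil \text{ for all } i} M(C_n).$$ 2. Let $1\le p<\infty$. The paths of $U^N$ lie in $L^p([0,1]^d)$. The sheet $U$ has a version that is jointly measurable in $(x,\omega)$; the paths of every such version lie in $L^p([0,1]^d)$ almost surely; and, as $L^p([0,1]^d)$-valued random variables, with $U$ represented by any such version, $$U^N\longrightarrow U \quad\text{in distribution on } L^p([0,1]^d)\quad\text{as } N\to\infty .$$ -/

import Mathlib

open MeasureTheory ProbabilityTheory Filter
open scoped Topology ENNReal unitInterval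

namespace StableSheet

section StableMeasures

variable {Ω E : Type*} [MeasurableSpace Ω] [MeasurableSpace E]

/-- The real random variable `X` has the symmetric `α`-stable law `S_α(s, 0, 0)`, i.e. its
characteristic function is `t ↦ exp (-s^α |t|^α)`. -/
def HasSymmStableLaw (P : Measure Ω) (α s : ℝ) (X : Ω → ℝ) : Prop :=
  Measurable X ∧
    ∀ t : ℝ, charFun (P.map X) t = ((Real.exp (-(s ^ α * |t| ^ α)) : ℝ) : ℂ)

/-- `M` is a symmetric `α`-stable random measure on `E` with control measure `m`. It is a function
of the measurable sets of finite `m`-measure (values on other sets play no role); each `M A` is a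
random variable with law `S_α(m(A)^{1/α}, 0, 0)`, `M` is independently scattered, and it is
`σ`-additive almost surely. The series in the last clause is the limit of its partial sums (it need
not converge absolutely). -/
structure IsSymmStableRandomMeasure (P : Measure Ω) (α : ℝ) (m : Measure E)
    (M : Set E → Ω → ℝ) : Prop where
  law : ∀ A : Set E, MeasurableSet A → m A < ∞ →
    HasSymmStableLaw P α ((m A).toReal ^ (1 / α)) (M A)
  indep : ∀ (ι : Type) [Finite ι] (A : ι → Set E), (∀ i, MeasurableSet (A i)) →
    (∀ i, m (A i) < ∞) → Pairwise (fun i j => Disjoint (A i) (A j)) →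
    iIndepFun (fun i => M (A i)) P
  sigma_additive : ∀ A : ℕ → Set E, (∀ j, MeasurableSet (A j)) →
    Pairwise (fun i j => Disjoint (A i) (A j)) → m (⋃ j, A j) < ∞ →
    ∀ᵐ ω ∂P, Tendsto (fun k : ℕ => ∑ j ∈ Finset.range k, M (A j) ω) atTop (𝓝 (M (⋃ j, A j) ω))

/-- The stochastic integral `∫ φ dM = ∑_c c M(φ = c)` of a simple function `φ`. The value `c = 0`,
for which the set `{φ = c}` may have infinite measure, contributes nothing. -/
noncomputable def simpleIntegral (M : Set E → Ω → ℝ) (φ : SimpleFunc E ℝ) (ω : Ω) : ℝ :=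
  ∑ c ∈ φ.range, c * M (φ ⁻¹' {c}) ω

/-- The random variable `X` is (a version of) the stochastic integral `∫ f dM`: the limit in
probability of the integrals of simple functions that converge to `f` in `L^α(E, m)`. -/
def IsStochIntegral (P : Measure Ω) (α : ℝ) (m : Measure E) (M : Set E → Ω → ℝ)
    (f : E → ℝ) (X : Ω → ℝ) : Prop :=
  Measurable X ∧ ∃ φ : ℕ → SimpleFunc E ℝ,
    (∀ k, MemLp (φ k) (ENNReal.ofReal α) m) ∧
    Tendsto (fun k => eLpNorm (fun x => φ k x - f x) (ENNReal.ofReal α) m) atTop (𝓝 0) ∧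
    TendstoInMeasure P (fun k => simpleIntegral M (φ k)) atTop X

end StableMeasures

/-- The cube `[0,1]^d`; its `volume` is Lebesgue measure. -/
abbrev Cube (d : ℕ) : Type := Fin d → I

section Sheets

variable {Ω : Type*} [MeasurableSpace Ω] {d : ℕ}

open Classical in
/-- The kernel `f(x, x')`, equal to `1` if `x'_i ≤ x_i` for all `i`, and to `0` otherwise. -/
noncomputable def sheetKernel (x x' : Cube d) : ℝ := if ∀ i, x' i ≤ x i then 1 else 0

/-- The random field `U` is the symmetric `α`-stable sheet `U(x) = ∫ f(x, x') M(dx')` (up to a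
version) driven by `M`. -/
def IsSheet (P : Measure Ω) (α : ℝ) (M : Set (Cube d) → Ω → ℝ) (U : Cube d → Ω → ℝ) : Prop :=
  ∀ x, IsStochIntegral P α volume M (sheetKernel x) (U x)

/-- For `0 ≤ x ≤ 1` the number `h ⌈x / h⌉ = ⌈N x⌉ / N`, with `h = 1 / N`, lies in `[0,1]`. -/
theorem ceil_div_mem (N : ℕ) (x : I) : (⌈(N : ℝ) * x⌉₊ : ℝ) / N ∈ I := by
  refine ⟨by positivity, div_le_one_of_le₀ ?_ (by positivity)⟩
  exact_mod_cast Nat.ceil_le.2 (mul_le_of_le_one_right (by positivity) x.2.2)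

/-- The grid point `h ⌈x / h⌉`, computed coordinatewise, where `h = 1 / N`. -/
noncomputable def gridPoint (N : ℕ) (x : Cube d) : Cube d :=
  fun i => ⟨(⌈(N : ℝ) * x i⌉₊ : ℝ) / N, ceil_div_mem N (x i)⟩

/-- The discretization `U^N(x) = U(h ⌈x / h⌉)`, `h = 1 / N`. -/
noncomputable def discretize (N : ℕ) (U : Cube d → Ω → ℝ) : Cube d → Ω → ℝ :=
  fun x => U (gridPoint N x)

/-- The hypercube `∏_i (h n_i, h (n_i + 1)]`, `h = 1 / N`, for `n ∈ {0, …, N - 1}^d`. -/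
def gridCell (N : ℕ) (n : Fin d → Fin N) : Set (Cube d) :=
  {x | ∀ i, ((n i : ℕ) : ℝ) / N < x i ∧ (x i : ℝ) ≤ (((n i : ℕ) : ℝ) + 1) / N}

noncomputable instance instMeasurableSpaceLpCube (p : ℝ≥0∞) [Fact (1 ≤ p)] :
    MeasurableSpace (Lp ℝ p (volume : Measure (Cube d))) := borel _

instance instBorelSpaceLpCube (p : ℝ≥0∞) [Fact (1 ≤ p)] :
    BorelSpace (Lp ℝ p (volume : Measure (Cube d))) := ⟨rfl⟩

open Classical in
/-- The sample path `x ↦ X(x, ω)` as an element of `L^p([0,1]^d)` (and `0` for those `ω` whose path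
is not in `L^p`). -/
noncomputable def pathLp (p : ℝ≥0∞) (X : Cube d → Ω → ℝ) (ω : Ω) :
    Lp ℝ p (volume : Measure (Cube d)) :=
  if h : MemLp (fun x => X x ω) p volume then h.toLp else 0

end Sheets

end StableSheet

/-!
The proof shows more than convergence in distribution: the discretizations converge to the sheet in
probability, as random elements of `L^p`.

The stochastic integral of the indicator function of a box is the mass of the box
(`stochIntegral_indicator_ae_eq`), because integrals of simple functions are stable with scale equal
to the `L^α` size of the integrand (`hasSymmStableLaw_simpleIntegral`). So almost surely `U(x)` is
the mass of `{x' ≤ x}`, and at a grid point it is the sum of the masses of the grid cells below, up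
to a null set (`Iic_corner_ae_eq`). Likewise `U^N(x) - U(x)` is the mass of a set of volume at most
`d / N`. As all stable variables of index `α` are multiples of a standard one, this tends to `0` in
probability, uniformly in `x` (`tendsto_iSup_measure_discretize_sub_ge`). A subsequence therefore
converges almost surely at each point, and its upper limit is a jointly measurable version.

Since `U(x)` in general has no moments of order `α` or higher, convergence in `L^p` cannot come from
moment estimates. Instead the suprema of the paths are controlled by Lévy's maximal inequality. For
partial sums `S_a` of a `d`-dimensional array of independent symmetric variables, reflection in one
coordinate after another gives `P(max_a |S_a| > t) ≤ 2^d P(|S| > t)`, where `S` is the sum of the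
whole array (`measure_exists_partialSum_gt_le`). For the masses of the grid cells `S` is the mass of
the cube, whatever `N` is, so the suprema of `U^N` are tight, and the essential supremum of a
measurable version of `U` inherits the bound (`measure_not_ae_abs_le`). By Fubini
`∫ min(1, |U^N - U|) dx` tends to `0` in probability, and for paths bounded by a constant this
quantity controls the distance in `L^p` (`eLpNorm_sub_le_truncDist`,
`tendstoInMeasure_pathLp`).
-/

namespace StableSheet

/-! ### Symmetric stable laws -/

section Laws

variable {Ω : Type*} [MeasurableSpace Ω] {P : Measure Ω}
  {α s s' : ℝ} {X Y Z : Ω → ℝ}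

lemma HasSymmStableLaw.map_eq [IsProbabilityMeasure P]
    (hX : HasSymmStableLaw P α s X) (hY : HasSymmStableLaw P α s Y) :
    P.map X = P.map Y := by
  have := Measure.isProbabilityMeasure_map (μ := P) hX.1.aemeasurable
  have := Measure.isProbabilityMeasure_map (μ := P) hY.1.aemeasurable
  refine Measure.ext_of_charFun ?_
  ext t
  rw [hX.2, hY.2]

lemma HasSymmStableLaw.const_mul (hZ : HasSymmStableLaw P α 1 Z) (hs : 0 ≤ s) :
    HasSymmStableLaw P α s (fun ω => s * Z ω) := by
  refine ⟨hZ.1.const_mul s, fun t => ?_⟩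
  rw [charFun_map_mul_comp hZ.1.aemeasurable, hZ.2, abs_mul, abs_of_nonneg hs,
    Real.mul_rpow hs (abs_nonneg t), Real.one_rpow, one_mul]

lemma HasSymmStableLaw.map_neg [IsProbabilityMeasure P] (hX : HasSymmStableLaw P α s X) :
    (P.map X).map (fun y => -y) = P.map X := by
  have h : HasSymmStableLaw P α s (fun ω => -X ω) := by
    refine ⟨hX.1.neg, fun t => ?_⟩
    have := charFun_map_mul_comp (μ := P) hX.1.aemeasurable (-1) t
    simp only [neg_one_mul] at this
    rw [this, hX.2, abs_neg]
  rw [Measure.map_map measurable_neg hX.1]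
  exact h.map_eq hX

lemma HasSymmStableLaw.ae_eq_zero [IsProbabilityMeasure P] (hα : 0 < α)
    (hX : HasSymmStableLaw P α 0 X) :
    X =ᵐ[P] 0 := by
  have := Measure.isProbabilityMeasure_map (μ := P) hX.1.aemeasurable
  have h : P.map X = Measure.dirac 0 := by
    refine Measure.ext_of_charFun ?_
    ext t
    rw [hX.2, charFun_dirac]
    simp [Real.zero_rpow hα.ne']
  have h0 : ∀ᵐ y ∂(P.map X), y = 0 := by
    rw [h, ae_dirac_eq]
    rfl
  exact ae_of_ae_map hX.1.aemeasurable h0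

/-- Stable variables are multiples of a standard one, so their tails grow with the scale. -/
lemma HasSymmStableLaw.measure_abs_ge_le [IsProbabilityMeasure P] (hX : HasSymmStableLaw P α s X)
    (hZ : HasSymmStableLaw P α 1 Z) (hs : 0 ≤ s) (hss : s ≤ s') (ε : ℝ) :
    P {ω | ε ≤ |X ω|} ≤ P {ω | ε ≤ |s' * Z ω|} := by
  have hm : MeasurableSet {y : ℝ | ε ≤ |y|} := measurableSet_le measurable_const measurable_id.abs
  calc P {ω | ε ≤ |X ω|} = P.map X {y : ℝ | ε ≤ |y|} := by
        rw [Measure.map_apply hX.1 hm]; rfl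
    _ = P {ω | ε ≤ |s * Z ω|} := by
        rw [hX.map_eq (hZ.const_mul hs), Measure.map_apply (hZ.1.const_mul s) hm]; rfl
    _ ≤ _ := by
        refine measure_mono fun ω hω => ?_
        refine le_trans (show ε ≤ |s * Z ω| from hω) ?_
        rw [abs_mul, abs_mul, abs_of_nonneg hs, abs_of_nonneg (hs.trans hss)]
        gcongr

lemma tendsto_measure_abs_mul_ge [IsProbabilityMeasure P] {ι : Type*} {l : Filter ι}
    [l.IsCountablyGenerated]
    (hZ : Measurable Z) {u : ι → ℝ} (hu : Tendsto u l (𝓝 0)) {ε : ℝ} (hε : 0 < ε) :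
    Tendsto (fun i => P {ω | ε ≤ |u i * Z ω|}) l (𝓝 0) := by
  rw [tendsto_iff_seq_tendsto]
  intro v hv
  have h : TendstoInMeasure P (fun k ω => u (v k) * Z ω) atTop (fun _ => (0 : ℝ)) := by
    refine tendstoInMeasure_of_tendsto_ae (fun k => (hZ.const_mul _).aestronglyMeasurable) ?_
    refine ae_of_all _ fun ω => ?_
    simpa using (hu.comp hv).mul_const (Z ω)
  rw [tendstoInMeasure_iff_norm] at h
  simpa [Function.comp_def, Real.norm_eq_abs] using h ε hε

lemma HasSymmStableLaw.tendstoInMeasure_zero [IsProbabilityMeasure P] {W : ℕ → Ω → ℝ} {u : ℕ → ℝ}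
    (hZ : HasSymmStableLaw P α 1 Z) (hW : ∀ k, HasSymmStableLaw P α (u k) (W k))
    (hu0 : ∀ k, 0 ≤ u k) (hu : Tendsto u atTop (𝓝 0)) :
    TendstoInMeasure P W atTop (fun _ => (0 : ℝ)) := by
  rw [tendstoInMeasure_iff_norm]
  intro ε hε
  simp only [sub_zero, Real.norm_eq_abs]
  exact tendsto_of_tendsto_of_tendsto_of_le_of_le tendsto_const_nhds
    (tendsto_measure_abs_mul_ge hZ.1 hu hε) (fun k => zero_le)
    (fun k => (hW k).measure_abs_ge_le hZ (hu0 k) le_rfl ε)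

end Laws

/-! ### Additivity of the random measure and integrals of simple functions -/

section RandomMeasure

variable {Ω E : Type*} [MeasurableSpace Ω] [MeasurableSpace E] {P : Measure Ω}
  {α : ℝ} {m : Measure E} {M : Set E → Ω → ℝ}

namespace IsSymmStableRandomMeasure

lemma measurable [IsFiniteMeasure m] (hM : IsSymmStableRandomMeasure P α m M)
    {A : Set E} (hA : MeasurableSet A) :
    Measurable (M A) := (hM.law A hA (measure_lt_top m A)).1

lemma ae_eq_zero_of_null [IsProbabilityMeasure P]
    (hM : IsSymmStableRandomMeasure P α m M) (hα : 0 < α) {A : Set E}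
    (hA : MeasurableSet A) (h0 : m A = 0) : M A =ᵐ[P] 0 := by
  have h := hM.law A hA (by simp [h0])
  rw [h0, ENNReal.toReal_zero, Real.zero_rpow (by positivity)] at h
  exact h.ae_eq_zero hα

lemma union_ae_eq [IsProbabilityMeasure P] [IsFiniteMeasure m]
    (hM : IsSymmStableRandomMeasure P α m M) (hα : 0 < α) {A B : Set E}
    (hA : MeasurableSet A) (hB : MeasurableSet B) (hAB : Disjoint A B) :
    M (A ∪ B) =ᵐ[P] fun ω => M A ω + M B ω := by
  -- The `σ`-additivity is applied to the sequence `A, B, ∅, ∅, …`.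
  let C : ℕ → Set E := fun j => if j = 0 then A else if j = 1 then B else ∅
  have hU : ⋃ j, C j = A ∪ B := by
    ext x
    simp only [Set.mem_iUnion, Set.mem_union, C]
    constructor
    · rintro ⟨j, hj⟩
      split_ifs at hj
      exacts [Or.inl hj, Or.inr hj, hj.elim]
    · rintro (h | h)
      exacts [⟨0, by simpa⟩, ⟨1, by simpa⟩]
  have hC : ∀ j, MeasurableSet (C j) := fun j => by
    dsimp only [C]; split_ifs; exacts [hA, hB, MeasurableSet.empty]
  have hd : Pairwise fun i j => Disjoint (C i) (C j) := fun i j hij => by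
    dsimp only [C]
    split_ifs with h1 h2 h3 h4 h5 h6
    all_goals first
      | exact absurd (h1.trans h2.symm) hij
      | exact hAB
      | exact hAB.symm
      | exact Set.disjoint_empty _
      | exact Set.empty_disjoint _
      | omega
  have h := hM.sigma_additive C hC hd (measure_lt_top m _)
  rw [hU] at h
  filter_upwards [h, hM.ae_eq_zero_of_null hα MeasurableSet.empty measure_empty] with ω h h0
  refine tendsto_nhds_unique h ?_
  refine tendsto_const_nhds.congr' ?_
  filter_upwards [eventually_ge_atTop 2] with k hk
  obtain ⟨k, rfl⟩ := Nat.exists_eq_add_of_le hk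
  rw [Finset.sum_range_add, Finset.sum_range_succ, Finset.sum_range_one]
  have : ∀ j ∈ Finset.range k, M (C (2 + j)) ω = 0 := fun j _ => by
    have : C (2 + j) = ∅ := by
      simp only [C]
      rw [if_neg (by omega), if_neg (by omega)]
    rw [this]; exact h0
  rw [Finset.sum_eq_zero this]
  simp [C]

lemma biUnion_ae_eq [IsProbabilityMeasure P] [IsFiniteMeasure m]
    (hM : IsSymmStableRandomMeasure P α m M) (hα : 0 < α) {ι : Type*}
    (s : Finset ι) {A : ι → Set E} (hA : ∀ i, MeasurableSet (A i))
    (hd : Pairwise fun i j => Disjoint (A i) (A j)) :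
    M (⋃ i ∈ s, A i) =ᵐ[P] fun ω => ∑ i ∈ s, M (A i) ω := by
  classical
  induction s using Finset.induction_on with
  | empty => simpa using! hM.ae_eq_zero_of_null hα MeasurableSet.empty measure_empty
  | insert i s hi ih =>
    rw [Finset.set_biUnion_insert]
    have hd' : Disjoint (A i) (⋃ j ∈ s, A j) := by
      simp only [Set.disjoint_iUnion_right]
      exact fun j hj => hd (ne_of_mem_of_not_mem hj hi).symm
    filter_upwards [hM.union_ae_eq hα (hA i) (s.measurableSet_biUnion fun j _ => hA j) hd', ih]
      with ω h1 h2
    rw [h1, h2, Finset.sum_insert hi]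

/-- Adding a null set does not change the value of the random measure. -/
lemma ae_eq_of_subset [IsProbabilityMeasure P] [IsFiniteMeasure m]
    (hM : IsSymmStableRandomMeasure P α m M) (hα : 0 < α)
    {A B : Set E} (hA : MeasurableSet A) (hB : MeasurableSet B) (hAB : A ⊆ B)
    (h0 : m (B \ A) = 0) : M B =ᵐ[P] M A := by
  have h := hM.union_ae_eq hα hA (hB.diff hA) Set.disjoint_sdiff_right
  rw [Set.union_sdiff_cancel hAB] at h
  filter_upwards [h, hM.ae_eq_zero_of_null hα (hB.diff hA) h0] with ω h1 h2
  rw [h1, h2, Pi.zero_apply, add_zero]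

/-- The integral of `g ∘ π` may be computed on the partition into level sets of `π`, which is finer
than the one into level sets of `g ∘ π`. Hence the integral is additive almost surely. -/
lemma simpleIntegral_map [IsProbabilityMeasure P] [IsFiniteMeasure m]
    (hM : IsSymmStableRandomMeasure P α m M) (hα : 0 < α) {β : Type*}
    (π : SimpleFunc E β) (g : β → ℝ) :
    simpleIntegral M (π.map g) =ᵐ[P] fun ω => ∑ q ∈ π.range, g q * M (π ⁻¹' {q}) ω := by
  classical
  have h : ∀ c ∈ (π.map g).range, ∀ᵐ ω ∂P, M (π.map g ⁻¹' {c}) ω =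
      ∑ q ∈ π.range with g q = c, M (π ⁻¹' {q}) ω := by
    intro c _
    have : (π.map g ⁻¹' {c}) = ⋃ q ∈ π.range.filter (g · = c), π ⁻¹' {q} := by
      ext x; simp
    rw [this]
    refine hM.biUnion_ae_eq hα _ (fun q => π.measurableSet_fiber q) fun q r hqr => ?_
    exact Disjoint.preimage _ (by simpa using hqr)
  filter_upwards [(ae_ball_iff (Finset.countable_toSet _)).2 h] with ω hω
  rw [simpleIntegral, ← Finset.sum_fiberwise_of_maps_to (t := (π.map g).range) (g := g)]
  · refine Finset.sum_congr rfl fun c hc => ?_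
    rw [hω c hc, Finset.mul_sum]
    refine Finset.sum_congr rfl fun q hq => ?_
    rw [(Finset.mem_filter.1 hq).2]
  · intro q hq
    rw [SimpleFunc.range_map]
    exact Finset.mem_image_of_mem g hq

lemma simpleIntegral_sub [IsProbabilityMeasure P] [IsFiniteMeasure m]
    (hM : IsSymmStableRandomMeasure P α m M) (hα : 0 < α)
    (φ ψ : SimpleFunc E ℝ) :
    simpleIntegral M (φ - ψ) =ᵐ[P] fun ω => simpleIntegral M φ ω - simpleIntegral M ψ ω := by
  filter_upwards [hM.simpleIntegral_map hα (φ.pair ψ) Prod.fst,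
    hM.simpleIntegral_map hα (φ.pair ψ) Prod.snd,
    hM.simpleIntegral_map hα (φ.pair ψ) (fun q => q.1 - q.2)] with ω h1 h2 h3
  have e1 : (φ.pair ψ).map Prod.fst = φ := rfl
  have e2 : (φ.pair ψ).map Prod.snd = ψ := rfl
  have e3 : (φ.pair ψ).map (fun q => q.1 - q.2) = φ - ψ := rfl
  rw [e1] at h1; rw [e2] at h2; rw [e3] at h3
  rw [h1, h2, h3, ← Finset.sum_sub_distrib]
  exact Finset.sum_congr rfl fun q _ => by ring

open Classical in
lemma simpleIntegral_indicator [IsProbabilityMeasure P]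
    (hM : IsSymmStableRandomMeasure P α m M) (hα : 0 < α) {B : Set E}
    (hB : MeasurableSet B) :
    simpleIntegral M (SimpleFunc.piecewise B hB (SimpleFunc.const E 1) (SimpleFunc.const E 0))
      =ᵐ[P] M B := by
  set ψ : SimpleFunc E ℝ :=
    SimpleFunc.piecewise B hB (SimpleFunc.const E 1) (SimpleFunc.const E 0) with hψ
  have hfib : ψ ⁻¹' {1} = B := by
    ext x
    by_cases h : x ∈ B <;> simp [hψ, h]
  filter_upwards [hM.ae_eq_zero_of_null hα MeasurableSet.empty measure_empty] with ω h0
  rw [simpleIntegral, Finset.sum_eq_single 1]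
  · rw [hfib, one_mul]
  · intro c hc hc1
    obtain ⟨x, rfl⟩ := SimpleFunc.mem_range.1 hc
    by_cases h : x ∈ B
    · exact absurd (by simp [hψ, h]) hc1
    · simp [hψ, h]
  · intro h1
    have : ψ ⁻¹' {1} = ∅ := by
      ext x
      simp only [Set.mem_preimage, Set.mem_singleton_iff, Set.mem_empty_iff_false, iff_false]
      exact fun hx => h1 (SimpleFunc.mem_range.2 ⟨x, hx⟩)
    rw [this, h0, Pi.zero_apply, mul_zero]

/-- The integral of a simple function is stable, with scale the `L^α` size of the integrand. -/
lemma hasSymmStableLaw_simpleIntegral [IsProbabilityMeasure P] [IsFiniteMeasure m]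
    (hM : IsSymmStableRandomMeasure P α m M) (hα : 0 < α)
    (φ : SimpleFunc E ℝ) :
    HasSymmStableLaw P α (eLpNorm φ (ENNReal.ofReal α) m).toReal (simpleIntegral M φ) := by
  have hmeas : ∀ c, Measurable (M (φ ⁻¹' {c})) := fun c => hM.measurable (φ.measurableSet_fiber c)
  refine ⟨?_, fun t => ?_⟩
  · unfold simpleIntegral
    exact Finset.measurable_sum _ fun c _ => (hmeas c).const_mul c
  have hind : iIndepFun (fun c : φ.range => fun ω => (c : ℝ) * M (φ ⁻¹' {(c : ℝ)}) ω) P := by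
    refine (hM.indep φ.range (fun c => φ ⁻¹' {(c : ℝ)}) (fun c => φ.measurableSet_fiber c)
      (fun c => measure_lt_top m _) fun c c' hcc => ?_).comp (fun c y => (c : ℝ) * y)
        fun c => measurable_const_mul _
    exact Disjoint.preimage _ (by simpa using fun h => hcc (Subtype.ext h))
  have hsum : simpleIntegral M φ =
      fun ω => ∑ c : φ.range, (c : ℝ) * M (φ ⁻¹' {(c : ℝ)}) ω := by
    ext ω
    exact (Finset.sum_coe_sort φ.range fun c => c * M (φ ⁻¹' {c}) ω).symm
  have hscale : (eLpNorm φ (ENNReal.ofReal α) m).toReal ^ α =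
      ∑ c : φ.range, |(c : ℝ)| ^ α * (m (φ ⁻¹' {(c : ℝ)})).toReal := by
    rw [Finset.sum_coe_sort φ.range fun c => |c| ^ α * (m (φ ⁻¹' {c})).toReal,
      eLpNorm_eq_eLpNorm' (by simpa using hα) (by simp), ENNReal.toReal_ofReal hα.le,
      SimpleFunc.eLpNorm'_eq, ENNReal.toReal_rpow, ← ENNReal.rpow_mul, one_div,
      inv_mul_cancel₀ hα.ne', ENNReal.rpow_one, ENNReal.toReal_sum]
    · refine Finset.sum_congr rfl fun c _ => ?_
      rw [ENNReal.toReal_mul, ← ENNReal.toReal_rpow]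
      simp
    · exact fun c _ => ENNReal.mul_ne_top (by simp [hα.le]) (measure_ne_top _ _)
  rw [hsum, hind.charFun_map_fun_sum_eq_prod
    (fun c : φ.range => ((hmeas c).const_mul (c : ℝ)).aemeasurable), Finset.prod_apply,
    hscale, Finset.sum_mul,
    ← Finset.sum_neg_distrib, Real.exp_sum, Complex.ofReal_prod]
  refine Finset.prod_congr rfl fun c _ => ?_
  rw [charFun_map_mul_comp (hmeas c).aemeasurable,
    (hM.law _ (φ.measurableSet_fiber _) (measure_lt_top m _)).2, abs_mul,
    Real.mul_rpow (abs_nonneg _) (abs_nonneg _), ← Real.rpow_mul ENNReal.toReal_nonneg, one_div,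
    inv_mul_cancel₀ hα.ne', Real.rpow_one]
  ring_nf

/-- The stochastic integral of the indicator function of `B` is `M B`: the difference between
`M B` and the integral of an approximating simple function is stable with vanishing scale. -/
lemma stochIntegral_indicator_ae_eq [IsProbabilityMeasure P] [IsFiniteMeasure m]
    (hM : IsSymmStableRandomMeasure P α m M) (hα : 0 < α)
    {Z : Ω → ℝ} (hZ : HasSymmStableLaw P α 1 Z) {B : Set E} (hB : MeasurableSet B) {X : Ω → ℝ}
    (hX : IsStochIntegral P α m M (B.indicator 1) X) : X =ᵐ[P] M B := by
  classical
  obtain ⟨-, φ, -, hφ, hlim⟩ := hX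
  set ψ : SimpleFunc E ℝ :=
    SimpleFunc.piecewise B hB (SimpleFunc.const E 1) (SimpleFunc.const E 0) with hψ
  have hψ1 : (ψ : E → ℝ) = B.indicator 1 := by
    ext x
    by_cases h : x ∈ B <;> simp [hψ, h]
  refine tendstoInMeasure_ae_unique hlim ?_
  have h0 : TendstoInMeasure P (fun k => simpleIntegral M (φ k - ψ)) atTop (fun _ => (0 : ℝ)) := by
    refine hZ.tendstoInMeasure_zero (fun k => hM.hasSymmStableLaw_simpleIntegral hα _)
      (fun k => ENNReal.toReal_nonneg) ?_
    have : Tendsto (fun k => eLpNorm (φ k - ψ : SimpleFunc E ℝ) (ENNReal.ofReal α) m) atTop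
        (𝓝 0) := by
      refine hφ.congr fun k => ?_
      rw [SimpleFunc.coe_sub, hψ1]; rfl
    exact (ENNReal.tendsto_toReal ENNReal.zero_ne_top).comp this
  have h1 := h0.congr_left (g := fun _ => (0 : ℝ))
    (f' := fun k ω => simpleIntegral M (φ k) ω - M B ω) fun k => by
      filter_upwards [hM.simpleIntegral_sub hα (φ k) ψ, hM.simpleIntegral_indicator hα hB]
        with ω h1 h2
      rw [h1, h2]
  rw [tendstoInMeasure_iff_norm] at h1 ⊢
  simpa using h1

end IsSymmStableRandomMeasure

end RandomMeasure

/-! ### Lévy's maximal inequality for arrays with several indices -/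

section LevyInequality

/-- The reflection argument: if every point of `B k`, or its image under the measure preserving map
`ρ k`, lies in `B K`, and `ρ k` leaves `B j` invariant for `j ≤ k`, then `⋃ k ≤ K, B k` has at most
twice the measure of `B K`. The union is decomposed according to the first `k` whose set `B k`
contains the given point. -/
lemma measure_biUnion_le_two_mul {S : Type*} [MeasurableSpace S] {μ : Measure S} {B : ℕ → Set S}
    (hB : ∀ k, MeasurableSet (B k)) {ρ : ℕ → S → S} (hρ : ∀ k, MeasurePreserving (ρ k) μ μ)
    {K : ℕ} (hinv : ∀ k, ∀ j ≤ k, ρ k ⁻¹' B j = B j)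
    (hsub : ∀ k ≤ K, B k ⊆ B K ∪ ρ k ⁻¹' B K) :
    μ (⋃ k ∈ Finset.range (K + 1), B k) ≤ 2 * μ (B K) := by
  have hD : ∀ k, MeasurableSet (disjointed B k) := fun k => MeasurableSet.disjointed hB k
  have hDinv : ∀ k, ρ k ⁻¹' disjointed B k = disjointed B k := fun k => by
    rw [disjointed_eq_inter_compl]
    simp only [Set.preimage_inter, Set.preimage_iInter, Set.preimage_compl]
    rw [hinv k k le_rfl]
    congr 1
    exact Set.iInter₂_congr fun j hj => by rw [hinv k j hj.le]
  have hUD : ⋃ k ∈ Finset.range (K + 1), B k = ⋃ k ∈ Finset.range (K + 1), disjointed B k := by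
    rw [biUnion_range_succ_disjointed, partialSups_eq_biSup]
    simp
  have hone : ∀ k ∈ Finset.range (K + 1),
      μ (disjointed B k) ≤ 2 * μ (disjointed B k ∩ B K) := by
    intro k hk
    have hcov : disjointed B k ⊆
        (disjointed B k ∩ B K) ∪ ρ k ⁻¹' (disjointed B k ∩ B K) := by
      intro x hx
      rw [Set.preimage_inter, hDinv]
      exact (hsub k (Nat.lt_succ_iff.1 (Finset.mem_range.1 hk)) (disjointed_subset B k hx)).imp
        (fun h => ⟨hx, h⟩) fun h => ⟨hx, h⟩
    refine (measure_mono hcov).trans ((measure_union_le _ _).trans ?_)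
    rw [(hρ k).measure_preimage ((hD k).inter (hB K)).nullMeasurableSet, two_mul]
  calc μ (⋃ k ∈ Finset.range (K + 1), B k)
      ≤ ∑ k ∈ Finset.range (K + 1), μ (disjointed B k) := by
        rw [hUD]; exact measure_biUnion_finset_le _ _
    _ ≤ ∑ k ∈ Finset.range (K + 1), 2 * μ (disjointed B k ∩ B K) := Finset.sum_le_sum hone
    _ = 2 * μ (⋃ k ∈ Finset.range (K + 1), disjointed B k ∩ B K) := by
        rw [← Finset.mul_sum, measure_biUnion_finset]
        · exact fun i _ j _ hij => ((disjoint_disjointed B) hij).mono Set.inter_subset_left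
            Set.inter_subset_left
        · exact fun k _ => (hD k).inter (hB K)
    _ ≤ 2 * μ (B K) := by
        gcongr
        exact Set.iUnion₂_subset fun k _ => Set.inter_subset_right

variable {d N : ℕ}

/-- The partial sum of the array `y` over the indices `n` with `n + 1 ≤ a` in every coordinate. -/
def partialSum (a : Fin d → ℕ) (y : (Fin d → Fin N) → ℝ) : ℝ :=
  ∑ n : Fin d → Fin N with ∀ i, (n i : ℕ) + 1 ≤ a i, y n

lemma measurable_partialSum (a : Fin d → ℕ) : Measurable (partialSum (N := N) a) :=
  Finset.measurable_sum _ fun n _ => measurable_pi_apply n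

/-- Change of sign of all entries whose `j`-th index is at least `k`. -/
def reflect (j : Fin d) (k : ℕ) (y : (Fin d → Fin N) → ℝ) : (Fin d → Fin N) → ℝ :=
  fun n => if k ≤ n j then -y n else y n

lemma partialSum_reflect_of_le {a : Fin d → ℕ} {j : Fin d} {k : ℕ} (h : a j ≤ k)
    (y : (Fin d → Fin N) → ℝ) : partialSum a (reflect j k y) = partialSum a y := by
  refine Finset.sum_congr rfl fun n hn => if_neg ?_
  have := (Finset.mem_filter.1 hn).2 j
  omega

/-- Reflecting the entries beyond level `a j` leaves, in the average with the original array, only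
the entries that contribute to the sum up to `a`. -/
lemma partialSum_update_add_reflect (a : Fin d → ℕ) (j : Fin d) (haj : a j ≤ N)
    (y : (Fin d → Fin N) → ℝ) :
    partialSum (Function.update a j N) y + partialSum (Function.update a j N) (reflect j (a j) y)
      = 2 * partialSum a y := by
  simp only [partialSum, Finset.sum_filter]
  rw [← Finset.sum_add_distrib, Finset.mul_sum]
  refine Finset.sum_congr rfl fun n _ => ?_
  by_cases h : ∀ i, (n i : ℕ) + 1 ≤ a i
  · have hu : ∀ i, (n i : ℕ) + 1 ≤ Function.update a j N i := fun i => by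
      rcases eq_or_ne i j with rfl | hij
      · simp
      · simpa [hij] using h i
    rw [if_pos hu, if_pos h, if_pos hu, reflect, if_neg (by have := h j; omega)]
    ring
  · rw [if_neg h]
    by_cases hu : ∀ i, (n i : ℕ) + 1 ≤ Function.update a j N i
    · have hj : a j ≤ n j := by
        by_contra hlt
        refine h fun i => ?_
        rcases eq_or_ne i j with rfl | hij
        · omega
        · simpa [hij] using hu i
      rw [if_pos hu, if_pos hu, reflect, if_pos hj]
      ring
    · rw [if_neg hu, if_neg hu]
      ring

/-- The event that some partial sum exceeds `t`, where only the upper summation limits of the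
coordinates in `J` vary. -/
def exceed (N : ℕ) (J : Finset (Fin d)) (t : ℝ) : Set ((Fin d → Fin N) → ℝ) :=
  {y | ∃ a : Fin d → ℕ, (∀ i, a i ≤ N) ∧ (∀ i ∉ J, a i = N) ∧ t < |partialSum a y|}

/-- Lévy's inequality in one coordinate, for the maximum over the coordinates in `J`. -/
lemma measure_exceed_insert_le {μ : Measure ((Fin d → Fin N) → ℝ)}
    (hμ : ∀ j k, MeasurePreserving (reflect (N := N) j k) μ μ) (J : Finset (Fin d)) (j : Fin d)
    (t : ℝ) : μ (exceed N (insert j J) t) ≤ 2 * μ (exceed N J t) := by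
  let B : ℕ → Set ((Fin d → Fin N) → ℝ) := fun k =>
    {y | ∃ a : Fin d → ℕ, (∀ i, a i ≤ N) ∧ (∀ i ∉ insert j J, a i = N) ∧ a j = k ∧
      t < |partialSum a y|}
  have hB : ∀ k, MeasurableSet (B k) := fun k => by
    have : B k = ⋃ a : {a : Fin d → ℕ // (∀ i, a i ≤ N) ∧ (∀ i ∉ insert j J, a i = N) ∧ a j = k},
        {y | t < |partialSum a.1 y|} := by
      ext y
      simp only [B, Set.mem_iUnion, Set.mem_ofPred_eq]
      exact ⟨fun ⟨a, h1, h2, h3, h4⟩ => ⟨⟨a, h1, h2, h3⟩, h4⟩,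
        fun ⟨⟨a, h1, h2, h3⟩, h4⟩ => ⟨a, h1, h2, h3, h4⟩⟩
    rw [this]
    exact MeasurableSet.iUnion fun a =>
      measurableSet_lt measurable_const (measurable_partialSum a.1).abs
  have hinv : ∀ k, ∀ l ≤ k, reflect j k ⁻¹' B l = B l := fun k l hl => by
    ext y
    refine exists_congr fun a => and_congr_right fun _ => and_congr_right fun _ =>
      and_congr_right fun h => ?_
    rw [partialSum_reflect_of_le (h.trans_le hl)]
  have hsub : ∀ k ≤ N, B k ⊆ B N ∪ reflect j k ⁻¹' B N := by
    rintro k hk y ⟨a, h1, h2, rfl, h4⟩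
    have hadd := partialSum_update_add_reflect a j hk y
    have hle : ∀ i, Function.update a j N i ≤ N := fun i => by
      rcases eq_or_ne i j with rfl | hij
      · simp
      · simpa [hij] using h1 i
    have heq : ∀ i ∉ insert j J, Function.update a j N i = N := fun i hi => by
      have hij : i ≠ j := fun h => hi (by rw [h]; exact Finset.mem_insert_self j J)
      rw [Function.update_of_ne hij, h2 i hi]
    by_cases h : t < |partialSum (Function.update a j N) y|
    · exact Or.inl ⟨_, hle, heq, by simp, h⟩
    · -- The sum up to `a` is the mean of the sum with `a j` replaced by `N` and its reflection,
      -- so one of the two exceeds `t` in absolute value.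
      refine Or.inr ⟨_, hle, heq, by simp, ?_⟩
      have := abs_add_le (partialSum (Function.update a j N) y)
        (partialSum (Function.update a j N) (reflect j (a j) y))
      rw [hadd, abs_mul, abs_two] at this
      linarith
  have h := measure_biUnion_le_two_mul hB (hμ j) hinv hsub
  refine (measure_mono ?_).trans (h.trans ?_)
  · rintro y ⟨a, h1, h2, h3⟩
    exact Set.mem_iUnion₂.2 ⟨a j, Finset.mem_range.2 (Nat.lt_succ_iff.2 (h1 j)), a, h1, h2, rfl, h3⟩
  · gcongr
    rintro y ⟨a, h1, h2, h3, h4⟩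
    refine ⟨a, h1, fun i hi => ?_, h4⟩
    rcases eq_or_ne i j with rfl | hij
    · exact h3
    · exact h2 i (by simp [hij, hi])

/-- Lévy's inequality, by induction on the set of coordinates in which the maximum is taken. -/
lemma measure_exceed_le {μ : Measure ((Fin d → Fin N) → ℝ)}
    (hμ : ∀ j k, MeasurePreserving (reflect (N := N) j k) μ μ) (J : Finset (Fin d)) (t : ℝ) :
    μ (exceed N J t) ≤ 2 ^ J.card * μ {y | t < |∑ n, y n|} := by
  induction J using Finset.induction_on with
  | empty =>
    rw [Finset.card_empty, pow_zero, one_mul]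
    refine measure_mono ?_
    rintro y ⟨a, -, h2, h3⟩
    have : partialSum a y = ∑ n, y n := by
      rw [partialSum, Finset.filter_true_of_mem]
      intro n _ i
      rw [h2 i (Finset.notMem_empty i)]
      exact (n i).2
    rwa [this] at h3
  | insert j J hj ih =>
    rw [Finset.card_insert_of_notMem hj, pow_succ', mul_assoc]
    exact (measure_exceed_insert_le hμ J j t).trans (by gcongr)

/-- Lévy's inequality for independent symmetric random variables with `d`-dimensional indices. -/
theorem measure_exists_partialSum_gt_le {Ω : Type*} [MeasurableSpace Ω] {P : Measure Ω}
    [IsProbabilityMeasure P] {ξ : (Fin d → Fin N) → Ω → ℝ} (hm : ∀ n, Measurable (ξ n))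
    (hind : iIndepFun ξ P) (hsymm : ∀ n, (P.map (ξ n)).map (fun y => -y) = P.map (ξ n)) (t : ℝ) :
    P {ω | ∃ a : Fin d → ℕ, (∀ i, a i ≤ N) ∧ t < |partialSum a (fun n => ξ n ω)|} ≤
      2 ^ d * P {ω | t < |∑ n, ξ n ω|} := by
  have hmeas : Measurable fun ω n => ξ n ω := measurable_pi_lambda _ hm
  have hlaw : P.map (fun ω n => ξ n ω) = Measure.pi fun n => P.map (ξ n) :=
    (iIndepFun_iff_map_fun_eq_pi_map fun n => (hm n).aemeasurable).1 hind
  have : ∀ n, IsProbabilityMeasure (P.map (ξ n)) := fun n =>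
    Measure.isProbabilityMeasure_map (hm n).aemeasurable
  have hμ : ∀ j k, MeasurePreserving (reflect (N := N) (d := d) j k)
      (P.map fun ω n => ξ n ω) (P.map fun ω n => ξ n ω) := by
    intro j k
    rw [hlaw]
    refine measurePreserving_pi (fun n => P.map (ξ n)) (fun n => P.map (ξ n))
      (f := fun (n : Fin d → Fin N) (y : ℝ) => if k ≤ (n j : ℕ) then -y else y) fun n => ?_
    by_cases h : k ≤ (n j : ℕ)
    · simp only [h, if_true]
      exact ⟨measurable_neg, hsymm n⟩
    · simp only [h, if_false]
      exact MeasurePreserving.id _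
  have hS : MeasurableSet {y : (Fin d → Fin N) → ℝ | t < |∑ n, y n|} :=
    measurableSet_lt measurable_const (Finset.measurable_sum _ fun n _ =>
      measurable_pi_apply n).abs
  have h := measure_exceed_le hμ Finset.univ t
  rw [Finset.card_univ, Fintype.card_fin, Measure.map_apply hmeas hS] at h
  refine (le_trans (measure_mono ?_) (Measure.le_map_apply hmeas.aemeasurable _)).trans h
  rintro ω ⟨a, h1, h2⟩
  exact ⟨a, h1, fun i hi => absurd (Finset.mem_univ i) hi, h2⟩

end LevyInequality

/-! ### Random fields that converge uniformly in probability -/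

section RandomFields

variable {Ω S : Type*} [MeasurableSpace S] {m : Measure S} {V W : S → Ω → ℝ}

/-- The truncated `L^1` distance `∫ min(1, |W - V|) dm` of the paths of two random fields. -/
noncomputable def truncDist (m : Measure S) (W V : S → Ω → ℝ) (ω : Ω) : ℝ≥0∞ :=
  ∫⁻ x, min 1 ‖W x ω - V x ω‖ₑ ∂m

/-- For bounded paths the `L^p` distance is controlled by the truncated `L^1` distance. -/
lemma eLpNorm_sub_le_truncDist {p : ℝ≥0∞} (hp1 : 1 ≤ p) (hp : p ≠ ∞) {ω : Ω} {t : ℝ} (ht : 0 ≤ t)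
    (hW : ∀ x, |W x ω| ≤ t) (hV : ∀ᵐ x ∂m, |V x ω| ≤ t + 1) :
    eLpNorm (fun x => W x ω - V x ω) p m ≤
      (ENNReal.ofReal (2 * t + 1) ^ p.toReal * truncDist m W V ω) ^ (1 / p.toReal) := by
  have hq : 1 ≤ p.toReal := by
    simpa using ENNReal.toReal_mono hp hp1
  have hc : 1 ≤ ENNReal.ofReal (2 * t + 1) := by
    rw [← ENNReal.ofReal_one]; exact ENNReal.ofReal_le_ofReal (by linarith)
  rw [eLpNorm_eq_lintegral_rpow_enorm_toReal (by positivity) hp, truncDist,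
    ← lintegral_const_mul' _ _ (ENNReal.rpow_ne_top_of_nonneg (by positivity)
      ENNReal.ofReal_ne_top)]
  refine ENNReal.rpow_le_rpow (lintegral_mono_ae ?_) (by positivity)
  filter_upwards [hV] with x hx
  have he : ‖W x ω - V x ω‖ₑ ≤ ENNReal.ofReal (2 * t + 1) := by
    rw [← ofReal_norm]
    refine ENNReal.ofReal_le_ofReal ((norm_sub_le _ _).trans ?_)
    have := hW x
    simp only [Real.norm_eq_abs]
    linarith
  generalize ‖W x ω - V x ω‖ₑ = e at he
  rcases le_total e 1 with h | h
  · rw [min_eq_right h]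
    calc e ^ p.toReal ≤ e ^ (1 : ℝ) := ENNReal.rpow_le_rpow_of_exponent_ge h hq
      _ = 1 * e := by rw [ENNReal.rpow_one, one_mul]
      _ ≤ _ := by
        gcongr
        exact ENNReal.one_le_rpow hc (by linarith)
  · rw [min_eq_left h, mul_one]
    gcongr

variable [MeasurableSpace Ω] {P : Measure Ω} {Y : ℕ → S → Ω → ℝ}

lemma measurable_min_one_enorm_sub (hW : Measurable (Function.uncurry W))
    (hV : Measurable (Function.uncurry V)) :
    Measurable fun q : S × Ω => min 1 ‖W q.1 q.2 - V q.1 q.2‖ₑ :=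
  measurable_const.min (hW.sub hV).enorm

lemma measurable_truncDist [SFinite m] (hW : Measurable (Function.uncurry W))
    (hV : Measurable (Function.uncurry V)) : Measurable (truncDist m W V) :=
  (measurable_min_one_enorm_sub hW hV).lintegral_prod_left'

lemma lintegral_truncDist_le [IsProbabilityMeasure P] [IsProbabilityMeasure m]
    (hW : Measurable (Function.uncurry W)) (hV : Measurable (Function.uncurry V)) (ε : ℝ) :
    ∫⁻ ω, truncDist m W V ω ∂P ≤ ENNReal.ofReal ε + ⨆ x, P {ω | ε ≤ |W x ω - V x ω|} := by
  unfold truncDist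
  have hmeas := measurable_min_one_enorm_sub hW hV
  rw [lintegral_lintegral_swap (f := fun ω x => min 1 ‖W x ω - V x ω‖ₑ)
    (hmeas.comp measurable_swap).aemeasurable]
  have hx : ∀ x, ∫⁻ ω, min 1 ‖W x ω - V x ω‖ₑ ∂P ≤
      ENNReal.ofReal ε + ⨆ x, P {ω | ε ≤ |W x ω - V x ω|} := by
    intro x
    have hA : MeasurableSet {ω | ε ≤ |W x ω - V x ω|} :=
      measurableSet_le measurable_const
        ((hW.comp measurable_prodMk_left).sub (hV.comp measurable_prodMk_left)).abs
    calc ∫⁻ ω, min 1 ‖W x ω - V x ω‖ₑ ∂P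
        ≤ ∫⁻ ω, (ENNReal.ofReal ε + {ω | ε ≤ |W x ω - V x ω|}.indicator 1 ω) ∂P := by
          refine lintegral_mono fun ω => ?_
          by_cases h : ε ≤ |W x ω - V x ω|
          · rw [Set.indicator_of_mem (show ω ∈ {ω | ε ≤ |W x ω - V x ω|} from h)]
            exact (min_le_left _ _).trans le_add_self
          · refine (min_le_right _ _).trans (le_trans ?_ le_self_add)
            rw [← ofReal_norm]
            exact ENNReal.ofReal_le_ofReal (not_le.1 h).le
      _ = ENNReal.ofReal ε + P {ω | ε ≤ |W x ω - V x ω|} := by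
          rw [lintegral_add_left measurable_const, lintegral_const, measure_univ, mul_one,
            lintegral_indicator_one hA]
      _ ≤ _ := by
          gcongr
          exact le_iSup (fun x => P {ω | ε ≤ |W x ω - V x ω|}) x
  refine (lintegral_mono hx).trans ?_
  rw [lintegral_const, measure_univ, mul_one]

lemma tendsto_measure_truncDist_ge [IsProbabilityMeasure P] [IsProbabilityMeasure m]
    (hY : ∀ N, Measurable (Function.uncurry (Y N))) (hV : Measurable (Function.uncurry V))
    (hunif : ∀ ε > 0, Tendsto (fun N => ⨆ x, P {ω | ε ≤ |Y N x ω - V x ω|}) atTop (𝓝 0))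
    {δ : ℝ≥0∞} (hδ : δ ≠ 0) (hδ' : δ ≠ ∞) :
    Tendsto (fun N => P {ω | δ ≤ truncDist m (Y N) V ω}) atTop (𝓝 0) := by
  have hE : Tendsto (fun N => ∫⁻ ω, truncDist m (Y N) V ω ∂P) atTop (𝓝 0) := by
    rw [ENNReal.tendsto_nhds_zero]
    intro η hη
    obtain ⟨ε, hε0, hεη⟩ : ∃ ε : ℝ, 0 < ε ∧ ENNReal.ofReal ε ≤ η / 2 := by
      obtain ⟨r, hr0, hr⟩ := ENNReal.lt_iff_exists_nnreal_btwn.1 (ENNReal.half_pos hη.ne')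
      exact ⟨r, by exact_mod_cast hr0, by simpa using hr.le⟩
    filter_upwards [ENNReal.tendsto_nhds_zero.1 (hunif ε hε0) (η / 2) (ENNReal.half_pos hη.ne')]
      with N hN
    calc _ ≤ _ := lintegral_truncDist_le (hY N) hV ε
      _ ≤ η / 2 + η / 2 := add_le_add hεη hN
      _ = η := ENNReal.add_halves η
  have hdiv := ENNReal.Tendsto.div_const hE (Or.inr hδ)
  rw [ENNReal.zero_div] at hdiv
  exact tendsto_of_tendsto_of_tendsto_of_le_of_le tendsto_const_nhds hdiv (fun _ => zero_le)
    fun N => meas_ge_le_lintegral_div (measurable_truncDist (hY N) hV).aemeasurable hδ hδ'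

/-- A tail bound for the suprema of the paths of `Y N` passes to the essential suprema of the paths
of the limit. -/
lemma measure_not_ae_abs_le [IsProbabilityMeasure P] [IsProbabilityMeasure m]
    (hY : ∀ N, Measurable (Function.uncurry (Y N))) (hV : Measurable (Function.uncurry V))
    (hunif : ∀ ε > 0, Tendsto (fun N => ⨆ x, P {ω | ε ≤ |Y N x ω - V x ω|}) atTop (𝓝 0))
    {t : ℝ} {τ : ℝ≥0∞} (hτ : ∀ᶠ N in atTop, P {ω | ∃ x, t < |Y N x ω|} ≤ τ) :
    P {ω | ¬ ∀ᵐ x ∂m, |V x ω| ≤ t + 1} ≤ τ := by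
  -- On `F k` the path of `V` exceeds `t + 1` on a set of mass at least `1 / (k + 1)`. If
  -- `|Y N| ≤ t`, the truncated distance is then at least `1 / (k + 1)`, an event of vanishing
  -- probability.
  let F : ℕ → Set Ω := fun k => {ω | ((k : ℝ≥0∞) + 1)⁻¹ ≤ m {x | t + 1 < |V x ω|}}
  have hF : ∀ k, P (F k) ≤ τ := by
    intro k
    have hδ : ((k : ℝ≥0∞) + 1)⁻¹ ≠ 0 := ENNReal.inv_ne_zero.2 (by simp)
    have hδ' : ((k : ℝ≥0∞) + 1)⁻¹ ≠ ∞ := ENNReal.inv_ne_top.2 (by simp)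
    have hlim : Tendsto (fun N => τ + P {ω | ((k : ℝ≥0∞) + 1)⁻¹ ≤ truncDist m (Y N) V ω}) atTop
        (𝓝 (τ + 0)) :=
      tendsto_const_nhds.add (tendsto_measure_truncDist_ge hY hV hunif hδ hδ')
    rw [add_zero] at hlim
    refine ge_of_tendsto hlim ?_
    filter_upwards [hτ] with N hN
    refine le_trans (measure_mono ?_) ((measure_union_le _ _).trans (add_le_add_left hN _))
    intro ω hω
    by_cases h : ∃ x, t < |Y N x ω|
    · exact Or.inl h
    · push Not at h
      refine Or.inr (le_trans (show ((k : ℝ≥0∞) + 1)⁻¹ ≤ _ from hω) ?_)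
      have hA : MeasurableSet {x | t + 1 < |V x ω|} :=
        measurableSet_lt measurable_const (hV.comp measurable_prodMk_right).abs
      rw [← lintegral_indicator_one hA]
      refine lintegral_mono fun x => ?_
      by_cases hx : t + 1 < |V x ω|
      · rw [Set.indicator_of_mem (show x ∈ {x | t + 1 < |V x ω|} from hx), Pi.one_apply]
        refine le_min le_rfl ?_
        rw [← ofReal_norm, ← ENNReal.ofReal_one]
        refine ENNReal.ofReal_le_ofReal ?_
        have h1 := abs_sub_abs_le_abs_sub (V x ω) (Y N x ω)
        rw [abs_sub_comm] at h1
        have h2 := h x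
        rw [Real.norm_eq_abs]
        linarith
      · rw [Set.indicator_of_notMem (show x ∉ {x | t + 1 < |V x ω|} from hx)]
        exact zero_le
  have hmono : Monotone F := fun k l hkl ω hω => by
    refine le_trans ?_ (show ((k : ℝ≥0∞) + 1)⁻¹ ≤ _ from hω)
    gcongr
  have hsub : {ω | ¬ ∀ᵐ x ∂m, |V x ω| ≤ t + 1} ⊆ ⋃ k, F k := by
    intro ω hω
    have hpos : m {x | t + 1 < |V x ω|} ≠ 0 := by
      intro h0
      refine hω ?_
      rw [ae_iff]
      simpa using h0
    obtain ⟨k, hk⟩ := ENNReal.exists_inv_nat_lt hpos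
    refine Set.mem_iUnion.2 ⟨k, le_trans ?_ hk.le⟩
    gcongr
    exact le_self_add
  refine (measure_mono hsub).trans ?_
  rw [hmono.measure_iUnion]
  exact iSup_le hF

lemma ae_exists_ae_abs_le [IsProbabilityMeasure P] [IsProbabilityMeasure m]
    (hY : ∀ N, Measurable (Function.uncurry (Y N))) (hV : Measurable (Function.uncurry V))
    (hunif : ∀ ε > 0, Tendsto (fun N => ⨆ x, P {ω | ε ≤ |Y N x ω - V x ω|}) atTop (𝓝 0))
    {τ : ℝ → ℝ≥0∞} (hτ : ∀ᶠ N in atTop, ∀ t, P {ω | ∃ x, t < |Y N x ω|} ≤ τ t)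
    (hτ0 : Tendsto τ atTop (𝓝 0)) :
    ∀ᵐ ω ∂P, ∃ t : ℝ, ∀ᵐ x ∂m, |V x ω| ≤ t := by
  rw [ae_iff, ← nonpos_iff_eq_zero]
  refine ge_of_tendsto hτ0 (Eventually.of_forall fun t => ?_)
  refine le_trans (measure_mono fun ω hω => ?_)
    (measure_not_ae_abs_le (m := m) hY hV hunif (hτ.mono fun N h => h t))
  exact fun h => hω ⟨t + 1, h⟩

lemma memLp_of_ae_abs_le [IsFiniteMeasure m] (hV : Measurable (Function.uncurry V)) (p : ℝ≥0∞)
    {ω : Ω} {t : ℝ} (h : ∀ᵐ x ∂m, |V x ω| ≤ t) : MemLp (fun x => V x ω) p m :=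
  MemLp.of_bound (hV.comp measurable_prodMk_right).aestronglyMeasurable t h

/-- A random field that is uniformly in probability the limit of jointly measurable fields has a
jointly measurable version: along a fast subsequence the convergence is almost sure at each
point. -/
lemma exists_measurable_version [IsProbabilityMeasure P] {U : S → Ω → ℝ}
    (hY : ∀ N, Measurable (Function.uncurry (Y N)))
    (hunif : ∀ ε > 0, Tendsto (fun N => ⨆ x, P {ω | ε ≤ |Y N x ω - U x ω|}) atTop (𝓝 0)) :
    ∃ V : S → Ω → ℝ, Measurable (Function.uncurry V) ∧ ∀ x, V x =ᵐ[P] U x := by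
  have hsel : ∀ k : ℕ, ∃ N, (⨆ x, P {ω | (1 / 2 : ℝ) ^ k ≤ |Y N x ω - U x ω|}) ≤ 2⁻¹ ^ k :=
    fun k => (ENNReal.tendsto_nhds_zero.1 (hunif ((1 / 2) ^ k) (by positivity)) (2⁻¹ ^ k)
      (by simp [pos_iff_ne_zero])).exists
  choose n hn using hsel
  -- The upper limit is measurable, and equals the limit wherever the latter exists.
  refine ⟨fun x ω => limsup (fun k => Y (n k) x ω) atTop,
    Measurable.limsup fun k => hY (n k), fun x => ?_⟩
  have hsum : ∑' k, P {ω | (1 / 2 : ℝ) ^ k ≤ |Y (n k) x ω - U x ω|} ≠ ∞ := by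
    refine ne_top_of_le_ne_top ?_ (ENNReal.tsum_le_tsum fun k =>
      (le_iSup (fun x => P {ω | (1 / 2 : ℝ) ^ k ≤ |Y (n k) x ω - U x ω|}) x).trans (hn k))
    rw [ENNReal.tsum_geometric]
    simp
  filter_upwards [ae_eventually_notMem hsum] with ω hω
  refine Tendsto.limsup_eq ?_
  rw [tendsto_iff_norm_sub_tendsto_zero]
  refine squeeze_zero' (Eventually.of_forall fun k => norm_nonneg _)
    (hω.mono fun k hk => ?_)
    (tendsto_pow_atTop_nhds_zero_of_lt_one (r := (1 / 2 : ℝ)) (by norm_num) (by norm_num))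
  exact (not_le.1 fun h => hk h).le

end RandomFields

/-! ### Paths as random elements of `L^p` -/

section Paths

variable {Ω : Type*} [MeasurableSpace Ω] {P : Measure Ω} {d : ℕ} {p : ℝ≥0∞}

lemma memLp_comp_of_finite {ι : Type*} [Finite ι] [MeasurableSpace ι] [MeasurableSingletonClass ι]
    {c : Cube d → ι} (hc : Measurable c) (g : ι → ℝ) :
    MemLp (fun x => g (c x)) p (volume : Measure (Cube d)) := by
  have := Fintype.ofFinite ι
  refine MemLp.of_bound ((measurable_of_countable g).comp hc).aestronglyMeasurable
    (∑ a, ‖g a‖) (ae_of_all _ fun x => ?_)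
  exact Finset.single_le_sum (f := fun a => ‖g a‖) (fun a _ => norm_nonneg _)
    (Finset.mem_univ (c x))

/-- A field that is constant on the pieces of a finite partition has measurable paths in `L^p`: the
path depends linearly on finitely many random variables. -/
lemma measurable_pathLp_comp [Fact (1 ≤ p)] {ι : Type*} [Finite ι] [MeasurableSpace ι]
    [MeasurableSingletonClass ι] {c : Cube d → ι} (hc : Measurable c) {G : ι → Ω → ℝ}
    (hG : ∀ a, Measurable (G a)) : Measurable (pathLp p fun x => G (c x)) := by
  let T : (ι → ℝ) →ₗ[ℝ] Lp ℝ p (volume : Measure (Cube d)) :=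
    { toFun := fun g => (memLp_comp_of_finite hc g).toLp
      map_add' := fun g g' =>
        (memLp_comp_of_finite hc g).toLp_add (memLp_comp_of_finite hc g')
      map_smul' := fun r g => (memLp_comp_of_finite hc g).toLp_const_smul r }
  have hT : (pathLp p fun x => G (c x)) = fun ω => T fun a => G a ω := by
    ext1 ω
    exact dif_pos (memLp_comp_of_finite hc fun a => G a ω)
  rw [hT]
  exact T.continuous_of_finiteDimensional.measurable.comp (measurable_pi_lambda _ hG)

/-- Uniform convergence in probability together with tightness of the suprema of the paths implies
convergence of the paths in probability in `L^p`. -/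
lemma tendstoInMeasure_pathLp [IsProbabilityMeasure P] [Fact (1 ≤ p)] (hp : p ≠ ∞)
    {V : Cube d → Ω → ℝ} {Y : ℕ → Cube d → Ω → ℝ}
    (hY : ∀ N, Measurable (Function.uncurry (Y N))) (hV : Measurable (Function.uncurry V))
    (hunif : ∀ ε > 0, Tendsto (fun N => ⨆ x, P {ω | ε ≤ |Y N x ω - V x ω|}) atTop (𝓝 0))
    {τ : ℝ → ℝ≥0∞} (hτ : ∀ᶠ N in atTop, ∀ t, P {ω | ∃ x, t < |Y N x ω|} ≤ τ t)
    (hτ0 : Tendsto τ atTop (𝓝 0)) :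
    TendstoInMeasure P (fun N => pathLp p (Y N)) atTop (pathLp p V) := by
  have hp1 : 1 ≤ p := Fact.out
  have hq : 0 < p.toReal := ENNReal.toReal_pos (by positivity) hp
  refine tendstoInMeasure_of_ne_top fun ε hε hε' => ?_
  rw [ENNReal.tendsto_nhds_zero]
  intro η hη
  have hη3 : 0 < η / 3 := ENNReal.div_pos hη.ne' (by simp)
  obtain ⟨t, htη, ht0⟩ :=
    ((ENNReal.tendsto_nhds_zero.1 hτ0 (η / 3) hη3).and (eventually_ge_atTop 0)).exists
  set C : ℝ≥0∞ := ENNReal.ofReal (2 * t + 1) ^ p.toReal with hC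
  have hC0 : C ≠ 0 := by
    have : 0 < 2 * t + 1 := by linarith
    exact (ENNReal.rpow_pos (by simpa using this) ENNReal.ofReal_ne_top).ne'
  have hC' : C ≠ ∞ := ENNReal.rpow_ne_top_of_nonneg hq.le ENNReal.ofReal_ne_top
  -- The threshold for the truncated distance below which the `L^p` distance is less than `ε`.
  have hδ : ε ^ p.toReal / C ≠ 0 :=
    (ENNReal.div_pos (ENNReal.rpow_pos hε hε').ne' hC').ne'
  have hδ' : ε ^ p.toReal / C ≠ ∞ :=
    ENNReal.div_ne_top (ENNReal.rpow_ne_top_of_nonneg hq.le hε') hC0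
  have hV1 := measure_not_ae_abs_le (m := (volume : Measure (Cube d))) hY hV hunif
    (hτ.mono fun N h => h t)
  filter_upwards [hτ, ENNReal.tendsto_nhds_zero.1
    (tendsto_measure_truncDist_ge (m := (volume : Measure (Cube d))) hY hV hunif hδ hδ')
    (η / 3) hη3] with N hN hD
  have hsub : {ω | ε ≤ edist (pathLp p (Y N) ω) (pathLp p V ω)} ⊆
      ({ω | ∃ x, t < |Y N x ω|} ∪ {ω | ¬ ∀ᵐ x ∂(volume : Measure (Cube d)), |V x ω| ≤ t + 1}) ∪
        {ω | ε ^ p.toReal / C ≤ truncDist volume (Y N) V ω} := by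
    intro ω hω
    by_contra hcon
    simp only [Set.mem_union, not_or] at hcon
    obtain ⟨⟨h1, h2⟩, h3⟩ := hcon
    replace h1 : ∀ x, |Y N x ω| ≤ t := fun x => not_lt.1 fun h => h1 ⟨x, h⟩
    replace h2 : ∀ᵐ x ∂(volume : Measure (Cube d)), |V x ω| ≤ t + 1 := not_not.1 h2
    replace h3 : truncDist volume (Y N) V ω < ε ^ p.toReal / C := not_le.1 h3
    have hYm := memLp_of_ae_abs_le (hY N) p (ae_of_all (volume : Measure (Cube d)) h1)
    have hVm := memLp_of_ae_abs_le hV p h2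
    have hlt : edist (pathLp p (Y N) ω) (pathLp p V ω) < ε := by
      rw [pathLp, pathLp, dif_pos hYm, dif_pos hVm, Lp.edist_toLp_toLp]
      refine (eLpNorm_sub_le_truncDist hp1 hp ht0 h1 h2).trans_lt ?_
      rw [one_div, ENNReal.rpow_inv_lt_iff hq, ← hC, mul_comm]
      exact ENNReal.mul_lt_of_lt_div h3
    exact absurd hω (not_le.2 hlt)
  calc P {ω | ε ≤ edist (pathLp p (Y N) ω) (pathLp p V ω)} ≤ η / 3 + η / 3 + η / 3 :=
        (measure_mono hsub).trans ((measure_union_le _ _).trans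
          (add_le_add ((measure_union_le _ _).trans
            (add_le_add ((hN t).trans htη) (hV1.trans htη))) hD))
    _ = η := ENNReal.add_thirds η

end Paths

/-! ### Grids in the cube -/

section Grid

variable {d : ℕ}

/-- The grid point `a / N`. -/
noncomputable def corner (N : ℕ) (a : Fin d → Fin (N + 1)) : Cube d := fun i =>
  ⟨((a i : ℕ) : ℝ) / N, by positivity,
    div_le_one_of_le₀ (by exact_mod_cast Nat.lt_succ_iff.1 (a i).2) (by positivity)⟩

/-- The vector `⌈N x⌉` of integers between `0` and `N`; by definition `gridPoint N x` is the corner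
with this index. -/
noncomputable def gridIndex (N : ℕ) (x : Cube d) : Fin d → Fin (N + 1) := fun i =>
  ⟨⌈(N : ℝ) * x i⌉₊, Nat.lt_succ_iff.2
    (Nat.ceil_le.2 (mul_le_of_le_one_right (by positivity) (x i).2.2))⟩

lemma measurable_gridIndex (N : ℕ) : Measurable (gridIndex (d := d) N) := by
  refine measurable_pi_lambda _ fun i => ?_
  have h : Measurable fun x : Cube d => ⌈(N : ℝ) * x i⌉₊ :=
    Nat.measurable_ceil.comp ((measurable_subtype_coe.comp (measurable_pi_apply i)).const_mul _)
  refine measurable_to_countable' fun k => ?_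
  convert h (measurableSet_singleton (k : ℕ)) using 1
  ext x
  simp [gridIndex, Fin.ext_iff]

lemma le_gridPoint {N : ℕ} (hN : 1 ≤ N) (x : Cube d) : x ≤ gridPoint N x := fun i => by
  have hN' : (0 : ℝ) < N := by exact_mod_cast hN
  change (x i : ℝ) ≤ (⌈(N : ℝ) * x i⌉₊ : ℝ) / N
  rw [le_div_iff₀ hN', mul_comm]
  exact Nat.le_ceil _

lemma gridPoint_sub_le {N : ℕ} (hN : 1 ≤ N) (x : Cube d) (i : Fin d) :
    (gridPoint N x i : ℝ) - x i ≤ 1 / N := by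
  have hN' : (0 : ℝ) < N := by exact_mod_cast hN
  change (⌈(N : ℝ) * x i⌉₊ : ℝ) / N - x i ≤ 1 / N
  have h := Nat.ceil_lt_add_one (show 0 ≤ (N : ℝ) * x i from mul_nonneg hN'.le (x i).2.1)
  rw [sub_le_iff_le_add, div_le_iff₀ hN', add_mul, div_mul_cancel₀ _ hN'.ne']
  linarith

lemma volume_eval_preimage (i : Fin d) {s : Set I} (hs : MeasurableSet s) :
    volume {y : Cube d | y i ∈ s} = volume s :=
  (measurePreserving_eval (fun _ : Fin d => (volume : Measure I)) i).measure_preimage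
    hs.nullMeasurableSet

lemma volume_Iic_gridPoint_diff_le {N : ℕ} (hN : 1 ≤ N) (x : Cube d) :
    (volume (Set.Iic (gridPoint N x) \ Set.Iic x)).toReal ≤ d / N := by
  have hsub : Set.Iic (gridPoint N x) \ Set.Iic x ⊆
      ⋃ i : Fin d, {y | y i ∈ Set.Ioc (x i) (gridPoint N x i)} := by
    rintro y ⟨h1, h2⟩
    obtain ⟨i, hi⟩ := not_forall.1 (show ¬ ∀ i, y i ≤ x i from h2)
    exact Set.mem_iUnion.2 ⟨i, not_le.1 hi, h1 i⟩
  refine ENNReal.toReal_le_of_le_ofReal (by positivity) ?_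
  calc volume (Set.Iic (gridPoint N x) \ Set.Iic x)
      ≤ ∑ i : Fin d, volume {y : Cube d | y i ∈ Set.Ioc (x i) (gridPoint N x i)} :=
        (measure_mono hsub).trans (measure_iUnion_fintype_le _ _)
    _ ≤ ∑ i : Fin d, ENNReal.ofReal (1 / N) := by
        refine Finset.sum_le_sum fun i _ => ?_
        rw [volume_eval_preimage i measurableSet_Ioc, unitInterval.volume_Ioc]
        exact ENNReal.ofReal_le_ofReal (gridPoint_sub_le hN x i)
    _ = ENNReal.ofReal (d / N) := by
        rw [Finset.sum_const, Finset.card_univ, Fintype.card_fin, nsmul_eq_mul,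
          ← ENNReal.ofReal_natCast d, ← ENNReal.ofReal_mul (by positivity), mul_one_div]

lemma gridCell_eq_pi (N : ℕ) (n : Fin d → Fin N) :
    gridCell N n = Set.univ.pi fun i =>
      Set.Ioc (corner N (fun i => (n i).castSucc) i) (corner N (fun i => (n i).succ) i) := by
  ext x
  simp only [gridCell, Set.mem_ofPred_eq, Set.mem_univ_pi, Set.mem_Ioc, ← Subtype.coe_lt_coe,
    ← Subtype.coe_le_coe, corner, Fin.val_castSucc, Fin.val_succ, Nat.cast_add, Nat.cast_one]

lemma measurableSet_gridCell (N : ℕ) (n : Fin d → Fin N) : MeasurableSet (gridCell N n) := by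
  rw [gridCell_eq_pi]
  exact MeasurableSet.univ_pi fun i => measurableSet_Ioc

lemma volume_gridCell (N : ℕ) (n : Fin d → Fin N) :
    (volume (gridCell N n)).toReal = (1 / (N : ℝ)) ^ d := by
  rw [gridCell_eq_pi, volume_pi_pi, ENNReal.toReal_prod]
  have : ∀ i ∈ (Finset.univ : Finset (Fin d)), (volume (Set.Ioc
      (corner N (fun i => (n i).castSucc) i) (corner N (fun i => (n i).succ) i))).toReal
        = 1 / (N : ℝ) := by
    intro i _
    rw [unitInterval.volume_Ioc]
    have h : ((corner N (fun i => (n i).succ) i : I) : ℝ) -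
        (corner N (fun i => (n i).castSucc) i : I) = 1 / N := by
      simp only [corner, Fin.val_castSucc, Fin.val_succ, Nat.cast_add, Nat.cast_one]
      ring
    rw [h, ENNReal.toReal_ofReal (by positivity)]
  rw [Finset.prod_congr rfl this, Finset.prod_const, Finset.card_univ, Fintype.card_fin]

lemma mem_gridCell_iff {N : ℕ} (hN : 1 ≤ N) (n : Fin d → Fin N) (x : Cube d) :
    x ∈ gridCell N n ↔ ∀ i, ⌈(N : ℝ) * x i⌉₊ = n i + 1 := by
  have hN' : (0 : ℝ) < N := by exact_mod_cast hN
  refine forall_congr' fun i => ?_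
  rw [Nat.ceil_eq_iff (by omega), div_lt_iff₀ hN', le_div_iff₀ hN', mul_comm (N : ℝ)]
  simp

lemma pairwise_disjoint_gridCell {N : ℕ} (hN : 1 ≤ N) :
    Pairwise fun n n' : Fin d → Fin N => Disjoint (gridCell N n) (gridCell N n') := by
  intro n n' hne
  refine Set.disjoint_left.2 fun x hx hx' => hne (funext fun i => Fin.ext ?_)
  rw [mem_gridCell_iff hN] at hx hx'
  have := (hx i).symm.trans (hx' i)
  omega

/-- The cells below a grid point fill the box below it up to points with a vanishing coordinate. -/
lemma biUnion_gridCell_subset {N : ℕ} (hN : 1 ≤ N) (a : Fin d → Fin (N + 1)) :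
    (⋃ n ∈ Finset.univ.filter fun n : Fin d → Fin N => ∀ i, (n i : ℕ) + 1 ≤ a i, gridCell N n) ⊆
        Set.Iic (corner N a) ∧
      Set.Iic (corner N a) \ (⋃ n ∈ Finset.univ.filter
        fun n : Fin d → Fin N => ∀ i, (n i : ℕ) + 1 ≤ a i, gridCell N n) ⊆
          ⋃ i, {y : Cube d | y i ∈ ({0} : Set I)} := by
  have hN' : (0 : ℝ) < N := by exact_mod_cast hN
  have hle : ∀ (y : Cube d) i, y i ≤ corner N a i ↔ ⌈(N : ℝ) * y i⌉₊ ≤ a i := fun y i => by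
    rw [Nat.ceil_le, ← Subtype.coe_le_coe, corner, le_div_iff₀ hN', mul_comm]
  constructor
  · refine Set.iUnion₂_subset fun n hn y hy i => ?_
    rw [hle, (mem_gridCell_iff hN n y).1 hy i]
    exact (Finset.mem_filter.1 hn).2 i
  · rintro y ⟨h1, h2⟩
    by_contra hy
    have hpos : ∀ i, 0 < ⌈(N : ℝ) * y i⌉₊ := fun i => by
      refine Nat.ceil_pos.2 (mul_pos hN' ((y i).2.1.lt_of_ne fun h => hy ?_))
      exact Set.mem_iUnion.2 ⟨i, Subtype.ext h.symm⟩
    have hya : ∀ i, ⌈(N : ℝ) * y i⌉₊ ≤ a i := fun i => (hle y i).1 (h1 i)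
    refine h2 (Set.mem_iUnion₂.2 ⟨fun i => ⟨⌈(N : ℝ) * y i⌉₊ - 1, ?_⟩, ?_, ?_⟩)
    · have := hpos i; have := hya i; have := (a i).2
      omega
    · refine Finset.mem_filter.2 ⟨Finset.mem_univ _, fun i => ?_⟩
      have := hpos i; have := hya i
      simp only
      omega
    · refine (mem_gridCell_iff hN _ y).2 fun i => ?_
      have := hpos i
      simp only
      omega

end Grid

/-! ### The stable sheet and its discretizations -/

section Sheet

variable {Ω : Type*} [MeasurableSpace Ω] {P : Measure Ω} {d : ℕ} {α : ℝ}
  {M : Set (Cube d) → Ω → ℝ} {U V : Cube d → Ω → ℝ}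

lemma sheetKernel_eq_indicator (x : Cube d) : sheetKernel x = (Set.Iic x).indicator 1 := by
  ext y
  by_cases h : ∀ i, y i ≤ x i
  · rw [sheetKernel, if_pos h, Set.indicator_of_mem (show y ∈ Set.Iic x from h), Pi.one_apply]
  · rw [sheetKernel, if_neg h, Set.indicator_of_notMem (show y ∉ Set.Iic x from h)]

namespace IsSymmStableRandomMeasure

lemma hasSymmStableLaw_univ (hM : IsSymmStableRandomMeasure P α volume M) :
    HasSymmStableLaw P α 1 (M Set.univ) := by
  have h := hM.law Set.univ MeasurableSet.univ (measure_lt_top _ _)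
  rwa [measure_univ, ENNReal.toReal_one, Real.one_rpow] at h

lemma sheet_ae_eq [IsProbabilityMeasure P] (hM : IsSymmStableRandomMeasure P α volume M)
    (hα : 0 < α) (hU : IsSheet P α M U) (x : Cube d) : U x =ᵐ[P] M (Set.Iic x) := by
  refine hM.stochIntegral_indicator_ae_eq hα hM.hasSymmStableLaw_univ measurableSet_Iic ?_
  rw [← sheetKernel_eq_indicator]
  exact hU x

/-- The increment of the sheet between a point and the grid point above it is stable with scale
at most `(d / N)^(1/α)`. -/
lemma measure_discretize_sub_ge_le [IsProbabilityMeasure P]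
    (hM : IsSymmStableRandomMeasure P α volume M) (hα : 0 < α) (hU : IsSheet P α M U)
    (hVU : ∀ x, V x =ᵐ[P] U x) {N : ℕ} (hN : 1 ≤ N) (x : Cube d) (ε : ℝ) :
    P {ω | ε ≤ |discretize N U x ω - V x ω|} ≤
      P {ω | ε ≤ |((d : ℝ) / N) ^ (1 / α) * M Set.univ ω|} := by
  have hA : MeasurableSet (Set.Iic (gridPoint N x) \ Set.Iic x) :=
    measurableSet_Iic.diff measurableSet_Iic
  have hadd := hM.union_ae_eq hα measurableSet_Iic hA Set.disjoint_sdiff_right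
  rw [Set.union_sdiff_cancel (Set.Iic_subset_Iic.2 (le_gridPoint hN x))] at hadd
  have heq : (fun ω => discretize N U x ω - V x ω) =ᵐ[P]
      M (Set.Iic (gridPoint N x) \ Set.Iic x) := by
    filter_upwards [hadd, hM.sheet_ae_eq hα hU (gridPoint N x), hM.sheet_ae_eq hα hU x, hVU x]
      with ω h1 h2 h3 h4
    rw [discretize, h2, h4, h3, h1, add_sub_cancel_left]
  have hcongr : P {ω | ε ≤ |discretize N U x ω - V x ω|} ≤
      P {ω | ε ≤ |M (Set.Iic (gridPoint N x) \ Set.Iic x) ω|} := by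
    refine measure_mono_ae ?_
    filter_upwards [heq] with ω h hω
    change ε ≤ |M (Set.Iic (gridPoint N x) \ Set.Iic x) ω|
    rw [← h]
    exact hω
  refine hcongr.trans ((hM.law _ hA (measure_lt_top _ _)).measure_abs_ge_le
    hM.hasSymmStableLaw_univ (by positivity) ?_ ε)
  exact Real.rpow_le_rpow ENNReal.toReal_nonneg (volume_Iic_gridPoint_diff_le hN x)
    (by positivity)

lemma tendsto_iSup_measure_discretize_sub_ge [IsProbabilityMeasure P]
    (hM : IsSymmStableRandomMeasure P α volume M) (hα : 0 < α) (hU : IsSheet P α M U)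
    (hVU : ∀ x, V x =ᵐ[P] U x) (ε : ℝ) (hε : 0 < ε) :
    Tendsto (fun N => ⨆ x, P {ω | ε ≤ |discretize N U x ω - V x ω|}) atTop (𝓝 0) := by
  have hu : Tendsto (fun N : ℕ => ((d : ℝ) / N) ^ (1 / α)) atTop (𝓝 0) := by
    have h := (tendsto_const_div_atTop_nhds_zero_nat (d : ℝ)).rpow_const
      (p := 1 / α) (Or.inr (by positivity))
    rwa [Real.zero_rpow (by positivity)] at h
  refine tendsto_of_tendsto_of_tendsto_of_le_of_le' tendsto_const_nhds
    (tendsto_measure_abs_mul_ge (P := P) (hM.measurable MeasurableSet.univ) hu hε)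
    (Eventually.of_forall fun N => zero_le) ?_
  filter_upwards [eventually_ge_atTop 1] with N hN
  exact iSup_le fun x => hM.measure_discretize_sub_ge_le hα hU hVU hN x ε

/-- The mass of the box below a grid point is the sum of the masses of the cells below it. -/
lemma Iic_corner_ae_eq [IsProbabilityMeasure P] (hM : IsSymmStableRandomMeasure P α volume M)
    (hα : 0 < α) {N : ℕ} (hN : 1 ≤ N) (a : Fin d → Fin (N + 1)) :
    M (Set.Iic (corner N a)) =ᵐ[P]
      fun ω => partialSum (fun i => (a i : ℕ)) fun n => M (gridCell N n) ω := by
  obtain ⟨h1, h2⟩ := biUnion_gridCell_subset hN a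
  have h0 : volume (⋃ i, {y : Cube d | y i ∈ ({0} : Set I)}) = 0 :=
    measure_iUnion_null fun i => by
      rw [volume_eval_preimage i (measurableSet_singleton 0), measure_singleton]
  exact (hM.ae_eq_of_subset hα (Finset.measurableSet_biUnion _ fun n _ =>
    measurableSet_gridCell N n) measurableSet_Iic h1 (measure_mono_null h2 h0)).trans
      (hM.biUnion_ae_eq hα _ (measurableSet_gridCell N) (pairwise_disjoint_gridCell hN))

lemma ae_discretize_eq_partialSum [IsProbabilityMeasure P]
    (hM : IsSymmStableRandomMeasure P α volume M) (hα : 0 < α) (hU : IsSheet P α M U) {N : ℕ}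
    (hN : 1 ≤ N) :
    ∀ᵐ ω ∂P, ∀ x, discretize N U x ω =
      partialSum (fun i => (gridIndex N x i : ℕ)) fun n => M (gridCell N n) ω := by
  have h : ∀ᵐ ω ∂P, ∀ a : Fin d → Fin (N + 1), U (corner N a) ω =
      partialSum (fun i => (a i : ℕ)) fun n => M (gridCell N n) ω :=
    ae_all_iff.2 fun a => (hM.sheet_ae_eq hα hU _).trans (hM.Iic_corner_ae_eq hα hN a)
  filter_upwards [h] with ω hω x
  exact hω (gridIndex N x)

lemma iIndepFun_gridCell (hM : IsSymmStableRandomMeasure P α volume M) {N : ℕ} (hN : 1 ≤ N) :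
    iIndepFun (fun n : Fin d → Fin N => M (gridCell N n)) P :=
  hM.indep _ (gridCell N) (measurableSet_gridCell N) (fun _ => measure_lt_top _ _)
    (pairwise_disjoint_gridCell hN)

/-- Lévy's inequality bounds the suprema of the discretizations by the total mass. -/
lemma measure_exists_discretize_gt_le [IsProbabilityMeasure P]
    (hM : IsSymmStableRandomMeasure P α volume M) (hα : 0 < α) (hU : IsSheet P α M U) {N : ℕ}
    (hN : 1 ≤ N) (t : ℝ) :
    P {ω | ∃ x, t < |discretize N U x ω|} ≤ 2 ^ d * P {ω | t < |M Set.univ ω|} := by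
  have hN' : (N : ℝ) ≠ 0 := by exact_mod_cast (show N ≠ 0 by omega)
  have htot : M Set.univ =ᵐ[P] fun ω => ∑ n : Fin d → Fin N, M (gridCell N n) ω := by
    have h := hM.Iic_corner_ae_eq hα hN (fun _ => Fin.last N)
    have htop : Set.Iic (corner N fun _ : Fin d => Fin.last N) = Set.univ := by
      refine Set.eq_univ_of_forall fun y i => ?_
      change (y i : ℝ) ≤ (N : ℝ) / N
      rw [div_self hN']
      exact (y i).2.2
    rw [htop] at h
    refine h.trans (ae_of_all _ fun ω => ?_)
    exact Finset.sum_congr (Finset.filter_true_of_mem fun n _ i => (n i).2) fun _ _ => rfl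
  have hlevy := measure_exists_partialSum_gt_le
    (fun n => hM.measurable (measurableSet_gridCell N n)) (hM.iIndepFun_gridCell hN)
    (fun n => (hM.law _ (measurableSet_gridCell N n) (measure_lt_top _ _)).map_neg) t
  refine (measure_mono_ae ?_).trans (hlevy.trans ?_)
  · filter_upwards [hM.ae_discretize_eq_partialSum hα hU hN] with ω hω
    rintro ⟨x, hx⟩
    rw [hω x] at hx
    exact ⟨_, fun i => Nat.lt_succ_iff.1 (gridIndex N x i).2, hx⟩
  · gcongr 2 ^ d * ?_
    refine measure_mono_ae ?_
    filter_upwards [htot] with ω hω h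
    change t < |M Set.univ ω|
    rw [hω]
    exact h

lemma tendsto_measure_abs_univ_gt [IsProbabilityMeasure P]
    (hM : IsSymmStableRandomMeasure P α volume M) :
    Tendsto (fun t : ℝ => 2 ^ d * P {ω | t < |M Set.univ ω|}) atTop (𝓝 0) := by
  have h : Tendsto (fun t : ℝ => P {ω | t < |M Set.univ ω|}) atTop (𝓝 0) := by
    refine tendsto_of_tendsto_of_tendsto_of_le_of_le' tendsto_const_nhds
      (tendsto_measure_abs_mul_ge (P := P) (hM.measurable MeasurableSet.univ) tendsto_inv_atTop_zero
        one_pos) (Eventually.of_forall fun t => zero_le) ?_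
    filter_upwards [eventually_gt_atTop 0] with t ht
    refine measure_mono fun ω hω => ?_
    change 1 ≤ |t⁻¹ * M Set.univ ω|
    rw [abs_mul, abs_of_pos (inv_pos.2 ht), inv_mul_eq_div, one_le_div ht]
    exact (show t < |M Set.univ ω| from hω).le
  simpa using ENNReal.Tendsto.const_mul h (Or.inr (by simp))

end IsSymmStableRandomMeasure

lemma measurable_uncurry_discretize (hU : IsSheet P α M U) (N : ℕ) :
    Measurable (Function.uncurry (discretize N U)) := by
  have h : Measurable fun q : (Fin d → Fin (N + 1)) × Ω => U (corner N q.1) q.2 :=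
    measurable_from_prod_countable_right fun a => (hU (corner N a)).1
  exact h.comp (((measurable_gridIndex N).comp measurable_fst).prodMk measurable_snd)

end Sheet

end StableSheet

open StableSheet in
theorem mainTheorem2 {Ω : Type*} [MeasurableSpace Ω] (P : Measure Ω) [IsProbabilityMeasure P]
    (d : ℕ) (α : ℝ) (hα0 : 0 < α) (hα2 : α < 2) (p : ℝ≥0∞) [Fact (1 ≤ p)] (hp : p ≠ ∞)
    (M : Set (Cube d) → Ω → ℝ) (hM : IsSymmStableRandomMeasure P α volume M)
    (U : Cube d → Ω → ℝ) (hU : IsSheet P α M U) :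
    -- the values of the discretizations are sums of i.i.d. stable increments over hypercubes
    (∀ N : ℕ, 1 ≤ N →
      iIndepFun (fun n : Fin d → Fin N => M (gridCell N n)) P ∧
      (∀ n : Fin d → Fin N,
        HasSymmStableLaw P α ((1 / (N : ℝ)) ^ ((d : ℝ) / α)) (M (gridCell N n))) ∧
      ∀ᵐ ω ∂P, ∀ x : Cube d, discretize N U x ω =
        ∑ n : Fin d → Fin N with ∀ i, (n i : ℕ) + 1 ≤ ⌈(N : ℝ) * x i⌉₊, M (gridCell N n) ω) ∧
    -- the sheet has a jointly measurable version
    (∃ V : Cube d → Ω → ℝ, Measurable (Function.uncurry V) ∧ ∀ x, V x =ᵐ[P] U x) ∧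
    -- the paths are in `L^p`, and the discretizations converge in distribution on `L^p`
    (∀ N ω, MemLp (fun x => discretize N U x ω) p volume) ∧
    ∀ V : Cube d → Ω → ℝ, Measurable (Function.uncurry V) → (∀ x, V x =ᵐ[P] U x) →
      (∀ᵐ ω ∂P, MemLp (fun x => V x ω) p volume) ∧
      TendstoInDistribution (fun N : ℕ => pathLp p (discretize N U)) atTop
        (pathLp p V) (fun _ => P) P := by
  have hmeas := measurable_uncurry_discretize hU
  have hτ : ∀ᶠ N in atTop, ∀ t, P {ω | ∃ x, t < |discretize N U x ω|} ≤
      2 ^ d * P {ω | t < |M Set.univ ω|} :=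
    (eventually_ge_atTop 1).mono fun N hN t => hM.measure_exists_discretize_gt_le hα0 hU hN t
  have hτ0 := hM.tendsto_measure_abs_univ_gt
  refine ⟨fun N hN => ⟨hM.iIndepFun_gridCell hN, fun n => ?_,
    hM.ae_discretize_eq_partialSum hα0 hU hN⟩, ?_, fun N ω => ?_, fun V hV hVU => ?_⟩
  · have h := hM.law _ (measurableSet_gridCell N n) (measure_lt_top _ _)
    rwa [volume_gridCell, ← Real.rpow_natCast, ← Real.rpow_mul (by positivity), mul_one_div] at h
  · exact exists_measurable_version hmeas
      (hM.tendsto_iSup_measure_discretize_sub_ge hα0 hU fun x => EventuallyEq.rfl)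
  · exact memLp_comp_of_finite (measurable_gridIndex N) fun a => U (corner N a) ω
  · have hunif := hM.tendsto_iSup_measure_discretize_sub_ge hα0 hU hVU
    constructor
    · filter_upwards [ae_exists_ae_abs_le (m := volume) hmeas hV hunif hτ hτ0] with ω hω
      obtain ⟨t, ht⟩ := hω
      exact memLp_of_ae_abs_le hV p ht
    · refine (tendstoInMeasure_pathLp hp hmeas hV hunif hτ hτ0).tendstoInDistribution
        fun N => ?_
      exact (measurable_pathLp_comp (measurable_gridIndex N)
        fun a => (hU (corner N a)).1).aemeasurable
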